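/- Let $\mathbf{F}_q$ be a finite field with $q$ elements ($q$ any prime power, odd or even) and let $n$ be a positive even integer. Let $\mathrm{sym}(m)$ be the number of invertible symmetric $m\times m$ matrices over $\mathbf{F}_q$, let $\mathrm{sym}_0(n)$ be the number of invertible symmetric $n\times n$ matrices over $\mathbf{F}_q$ whose diagonal entries are all zero, and for $0\le k\le n$ let $\mathrm{sym}_0(n,k)$ be the number of invertible symmetric $n\times n$ matrices over $\mathbf{F}_q$ whose first $k$ diagonal entries are zero (with no condition on the other entries). Then $$\mathrm{sym}(n-1)=\mathrm{sym}_0(n),$$ and for every integer $k$ with $0\le k\le n$, $$q^k\,\mathrm{sym}_0(n,k)=\mathrm{sym}_0(n,0)=\mathrm{sym}(n).$$ -/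

import Mathlib

/-- The set of invertible symmetric `n × n` matrices over `F`. -/
def InvSymm (F : Type*) [Field F] (n : ℕ) : Set (Matrix (Fin n) (Fin n) F) :=
  {A | A.IsSymm ∧ IsUnit A}

/-- The set of invertible symmetric `n × n` matrices over `F` whose diagonal is zero. -/
def InvSymmZeroDiag (F : Type*) [Field F] (n : ℕ) : Set (Matrix (Fin n) (Fin n) F) :=
  {A | A.IsSymm ∧ IsUnit A ∧ ∀ i, A i i = 0}

/-- The set of invertible symmetric `n × n` matrices over `F` whose first `k` diagonal
entries are zero (the remaining diagonal entries are arbitrary). -/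
def InvSymmFirstZero (F : Type*) [Field F] (n k : ℕ) : Set (Matrix (Fin n) (Fin n) F) :=
  {A | A.IsSymm ∧ IsUnit A ∧ ∀ i : Fin n, (i : ℕ) < k → A i i = 0}

theorem invSymmFirstZero_zero (F : Type*) [Field F] (n : ℕ) :
    InvSymmFirstZero F n 0 = InvSymm F n := by
  ext A
  simp [InvSymmFirstZero, InvSymm]

theorem invSymmFirstZero_self (F : Type*) [Field F] (n : ℕ) :
    InvSymmFirstZero F n n = InvSymmZeroDiag F n := by
  ext A
  simp [InvSymmFirstZero, InvSymmZeroDiag]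

open Matrix

/-!
Write a symmetric matrix of even size `n` as a block `B` of size `n - 1` bordered by a corner entry
`x` and a vector `v`. Its determinant is affine in `x` with slope `det B`, and vanishes exactly when
`x = vᵀB⁻¹v` if `B` is invertible. Since a nondegenerate symmetric form `v ↦ vᵀB⁻¹v` of odd rank
`n - 1` has exactly `q ^ (n - 2)` isotropic vectors, freeing a corner entry required to be zero
multiplies the number of invertible matrices by `q`, and so does freeing any other diagonal entry.

The isotropic vectors are counted as follows. In odd characteristic, diagonalizing the form and
expanding in additive characters leaves an odd power of the quadratic character, whose sum vanishes.
In characteristic two `v ↦ vᵀCv` is additive, and it is onto because a matrix of odd size with zero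
diagonal is singular.

Finally, the corner entry of `A⁻¹` is `det B / det A`, so inversion matches the invertible `A` with
`B` singular to those with zero corner entry, a proportion `1 / q` of all. Those with `B`
invertible number `(q - 1) q ^ (n - 1) sym(n - 1)`, the choices of `B`, `v` and `x ≠ vᵀB⁻¹v`. Hence
`sym(n) = q ^ n sym(n - 1)`, to be compared with `sym(n) = q ^ n sym₀(n)`.
-/

theorem addChar_sum {A M ι : Type*} [AddCommMonoid A] [CommMonoid M] (ψ : AddChar A M)
    (s : Finset ι) (f : ι → A) : ψ (∑ i ∈ s, f i) = ∏ i ∈ s, ψ (f i) :=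
  map_prod ψ.toMonoidHom (fun i ↦ Multiplicative.ofAdd (f i)) s

section OddCharacteristic

variable {F R : Type*} [Field F] [Fintype F] [DecidableEq F] [CommRing R] [IsDomain R]

theorem sum_addChar_sq (hF : ringChar F ≠ 2) {ψ : AddChar F R} (hψ : ψ ≠ 1) :
    ∑ x, ψ (x ^ 2) = gaussSum ((quadraticChar F).ringHomComp (Int.castRingHom R)) ψ := calc
  ∑ x, ψ (x ^ 2) = ∑ y, ∑ x with x ^ 2 = y, ψ (x ^ 2) := (Finset.sum_fiberwise _ _ _).symm
  _ = ∑ y, ((quadraticChar F y + 1 : ℤ) : R) * ψ y := by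
    refine Finset.sum_congr rfl fun y _ ↦ ?_
    rw [← quadraticChar_card_sqrts hF, Finset.sum_congr rfl (g := fun _ ↦ ψ y) (by simp_all)]
    simp
  _ = gaussSum ((quadraticChar F).ringHomComp (Int.castRingHom R)) ψ := by
    simp [gaussSum, add_mul, Finset.sum_add_distrib, AddChar.sum_eq_zero_of_ne_one hψ]

theorem sum_addChar_mul_sq (hF : ringChar F ≠ 2) {ψ : AddChar F R} (hψ : ψ.IsPrimitive) {a : F}
    (ha : a ≠ 0) : ∑ x, ψ (a * x ^ 2) = quadraticChar F a * ∑ x, ψ (x ^ 2) := by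
  have hψ₁ : ψ ≠ 1 := by simpa using hψ one_ne_zero
  have hshift : ∑ x, ψ (a * x ^ 2) =
      gaussSum ((quadraticChar F).ringHomComp (Int.castRingHom R)) (ψ.mulShift a) :=
    sum_addChar_sq hF (hψ ha)
  have hmul := gaussSum_mulShift_eq ((quadraticChar F).ringHomComp (Int.castRingHom R)) ψ
    (Units.mk0 a ha)
  rw [((quadraticChar_isQuadratic F).comp _).inv] at hmul
  rw [hshift, sum_addChar_sq hF hψ₁]
  exact hmul

variable {V : Type*} [AddCommGroup V] [Module F V] [Fintype V]

theorem sum_addChar_mul_bilinForm (hF : ringChar F ≠ 2) {ψ : AddChar F R} (hψ : ψ.IsPrimitive)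
    {B : LinearMap.BilinForm F V} (hB : B.IsSymm) (hnondeg : B.Nondegenerate) {a : F}
    (ha : a ≠ 0) :
    ∑ v, ψ (a * B v v) = (quadraticChar F a : R) ^ Module.finrank F V * ∑ v, ψ (B v v) := by
  let _ : Invertible (2 : F) := invertibleOfNonzero (Ring.two_ne_zero hF)
  have hQ : (QuadraticMap.associated (R := F) B.toQuadraticMap).SeparatingLeft := by
    rw [QuadraticMap.associated_left_inverse F hB.eq]
    exact hnondeg.1
  obtain ⟨w, ⟨e⟩⟩ := QuadraticForm.equivalent_weightedSumSquares_units_of_nondegenerate' _ hQ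
  have hdiag (c : F) : ∑ v, ψ (c * B v v) = ∏ i, ∑ x, ψ (c * w i * x ^ 2) := by
    rw [← e.symm.toEquiv.sum_comp, Fintype.prod_sum]
    refine Finset.sum_congr rfl fun x _ ↦ ?_
    have hx : B (e.symm x) (e.symm x) = ∑ i, w i * x i ^ 2 := by
      have happ : B (e.symm x) (e.symm x) = _ := e.symm.map_app x
      simpa only [QuadraticMap.weightedSumSquares_apply, Units.smul_def, smul_eq_mul, ← sq] using
        happ
    rw [← addChar_sum]
    simp only [mul_assoc, ← Finset.mul_sum]
    exact congrArg (fun y ↦ ψ (c * y)) hx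
  calc ∑ v, ψ (a * B v v)
    _ = ∏ i, (quadraticChar F a * ∑ x, ψ (1 * w i * x ^ 2)) := by
      rw [hdiag]
      refine Finset.prod_congr rfl fun i _ ↦ ?_
      rw [sum_addChar_mul_sq hF hψ (mul_ne_zero ha (w i).ne_zero), one_mul,
        sum_addChar_mul_sq hF hψ (w i).ne_zero, map_mul, Int.cast_mul, mul_assoc]
    _ = (quadraticChar F a : R) ^ Module.finrank F V * ∑ v, ψ (B v v) := by
      rw [Finset.prod_mul_distrib, ← hdiag]
      simp only [one_mul, Finset.prod_const, Finset.card_univ, Fintype.card_fin]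

end OddCharacteristic

theorem card_mul_card_isotropic_of_odd_finrank {F V : Type*} [Field F] [Finite F] [AddCommGroup V]
    [Module F V] [Finite V] (hF : ringChar F ≠ 2) (hV : Odd (Module.finrank F V))
    {B : LinearMap.BilinForm F V} (hB : B.IsSymm) (hnondeg : B.Nondegenerate) :
    Nat.card F * Nat.card {v // B v v = 0} = Nat.card V := by
  classical
  cases nonempty_fintype F
  cases nonempty_fintype V
  let ψ := AddChar.FiniteField.primitiveChar_to_Complex F
  have hψ : ψ.IsPrimitive := AddChar.FiniteField.primitiveChar_to_Complex_isPrimitive F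
  have hsum (a : F) : ∑ v, ψ (a * B v v) =
      (if a = 0 then (Nat.card V : ℂ) else 0) + quadraticChar F a * ∑ v, ψ (B v v) := by
    by_cases ha : a = 0
    · simp [ha]
    · have hpow : (quadraticChar F a : ℂ) ^ Module.finrank F V = quadraticChar F a := by
        rw [← Int.cast_pow, ← MulChar.pow_apply' _ hV.pos.ne',
          (quadraticChar_isQuadratic F).pow_odd hV]
      rw [sum_addChar_mul_bilinForm hF hψ hB hnondeg ha, hpow, if_neg ha, zero_add]
  suffices (Nat.card F : ℂ) * Nat.card {v // B v v = 0} = Nat.card V by exact_mod_cast this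
  calc (Nat.card F : ℂ) * Nat.card {v // B v v = 0}
    _ = ∑ v, ∑ a, ψ (a * B v v) := by
      simp [AddChar.sum_mulShift _ hψ, Fintype.card_subtype, mul_comm, ← Finset.sum_filter]
    _ = ∑ a, ∑ v, ψ (a * B v v) := Finset.sum_comm
    _ = Nat.card V + ((∑ a, quadraticChar F a : ℤ) : ℂ) * ∑ v, ψ (B v v) := by
      simp only [hsum, Finset.sum_add_distrib, Finset.sum_ite_eq', Finset.mem_univ, if_true,
        Int.cast_sum, Finset.sum_mul]
    _ = Nat.card V := by rw [quadraticChar_sum_zero hF, Int.cast_zero, zero_mul, add_zero]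

theorem card_mul_card_isotropic_of_charTwo {F V : Type*} [Field F] [Finite F] [CharP F 2]
    [AddCommGroup V] [Module F V] {B : LinearMap.BilinForm F V} (hB : B.IsSymm) {u : V}
    (hu : B u u ≠ 0) :
    Nat.card F * Nat.card {v // B v v = 0} = Nat.card V := by
  let f : V →+ F :=
    { toFun v := B v v
      map_zero' := by simp
      map_add' v w := by
        have hvw : B w v = B v w := hB.eq w v
        simp only [map_add, LinearMap.add_apply, hvw]
        linear_combination CharTwo.add_self_eq_zero (B v w) }
  have hf : Function.Surjective f := fun y ↦ by
    obtain ⟨z, hz⟩ := Finite.surjective_of_injective (frobenius_inj F 2) (y / B u u)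
    refine ⟨z • u, ?_⟩
    change B (z • u) (z • u) = y
    rw [frobenius_def, eq_div_iff hu] at hz
    rw [map_smul, map_smul, LinearMap.smul_apply, smul_eq_mul, smul_eq_mul, ← hz]
    ring
  have hindex : f.ker.index = Nat.card F := by
    rw [AddSubgroup.index_ker, AddMonoidHom.range_eq_top.2 hf, AddSubgroup.card_top]
  rw [← hindex, mul_comm]
  exact f.ker.card_mul_index

theorem det_eq_zero_of_isSymm_of_diag_eq_zero {R m : Type*} [CommRing R] [CharP R 2] [Fintype m]
    [DecidableEq m] (hm : Odd (Fintype.card m)) {C : Matrix m m R} (hC : C.IsSymm)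
    (hdiag : ∀ i, C i i = 0) : C.det = 0 := by
  rw [det_apply]
  -- The terms of `σ` and `σ⁻¹` agree, and an involution of an odd set has a fixed point.
  refine Finset.sum_involution (fun σ _ ↦ σ⁻¹) ?_ ?_ (fun _ _ ↦ Finset.mem_univ _) (by simp)
  · intro σ _
    have hprod : ∏ i, C (σ⁻¹ i) i = ∏ i, C (σ i) i := by
      rw [← Equiv.prod_comp σ]
      exact Finset.prod_congr rfl fun i _ ↦ by simp [hC.apply]
    rw [hprod, Equiv.Perm.sign_inv]
    exact CharTwo.add_self_eq_zero _
  · intro σ _ hne hinv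
    have hsq : σ ^ 2 = 1 := by rw [sq, mul_eq_one_iff_inv_eq, hinv]
    obtain ⟨i, hi⟩ := Equiv.Perm.exists_fixed_point_of_prime (p := 2) (n := 1)
      hm.not_two_dvd_nat (by simpa using hsq)
    exact hne (by rw [Finset.prod_eq_zero (Finset.mem_univ i) (by rw [hi, hdiag]), smul_zero])

theorem card_mul_card_dotProduct_mulVec_eq_zero {F m : Type*} [Field F] [Finite F] [Fintype m]
    [DecidableEq m] (hm : Odd (Fintype.card m)) {C : Matrix m m F} (hC : C.IsSymm)
    (hunit : IsUnit C) :
    Nat.card F * Nat.card {v // v ⬝ᵥ C *ᵥ v = 0} = Nat.card (m → F) := by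
  have hdet : C.det ≠ 0 := ((isUnit_iff_isUnit_det C).1 hunit).ne_zero
  have hB : (toBilin' C).IsSymm := isSymm_toBilin'_iff_isSymm.2 hC
  simp only [← toBilin'_apply']
  by_cases hF : ringChar F = 2
  · have : CharP F 2 := ringChar.of_eq hF
    have hdiag : ∃ i, C i i ≠ 0 := by
      by_contra! hzero
      exact hdet (det_eq_zero_of_isSymm_of_diag_eq_zero hm hC hzero)
    obtain ⟨i, hi⟩ := hdiag
    exact card_mul_card_isotropic_of_charTwo hB (u := Pi.single i 1) (by simpa using hi)
  · exact card_mul_card_isotropic_of_odd_finrank hF (by simpa using hm) hB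
      (LinearMap.BilinForm.nondegenerate_toBilin'_of_det_ne_zero' C hdet)

theorem card_fst_ne_add_card {α β : Type*} [Finite α] [Finite β] (f : β → α) :
    Nat.card {p : α × β // p.1 ≠ f p.2} + Nat.card β = Nat.card α * Nat.card β := by
  classical
  have hgraph : {p : α × β // p.1 = f p.2} ≃ β :=
    { toFun p := p.1.2
      invFun b := ⟨(f b, b), rfl⟩
      left_inv p := Subtype.ext (Prod.ext p.2.symm rfl)
      right_inv _ := rfl }
  rw [← Nat.card_prod, ← Nat.card_congr (Equiv.sumCompl fun p : α × β ↦ p.1 = f p.2), Nat.card_sum,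
    Nat.card_congr hgraph, add_comm]

/-- The invertible symmetric matrices whose diagonal vanishes on `Z`. Allowing any set `Z`
of indices from any finite type lets the diagonal entries be freed one at a time in any order. -/
def InvSymmZeroOn (R : Type*) [CommRing R] {ι : Type*} [Fintype ι] [DecidableEq ι] (Z : Set ι) :
    Set (Matrix ι ι R) :=
  {A | A.IsSymm ∧ IsUnit A ∧ ∀ i ∈ Z, A i i = 0}

theorem invSymmZeroOn_empty {R ι : Type*} [CommRing R] [Fintype ι] [DecidableEq ι] :
    InvSymmZeroOn R (∅ : Set ι) = {A | A.IsSymm ∧ IsUnit A} := by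
  simp [InvSymmZeroOn]

theorem card_invSymmZeroOn_preimage {R ι κ : Type*} [CommRing R] [Fintype ι] [DecidableEq ι]
    [Fintype κ] [DecidableEq κ] (e : ι ≃ κ) (Z : Set κ) :
    Nat.card (InvSymmZeroOn R (e ⁻¹' Z)) = Nat.card (InvSymmZeroOn R Z) := by
  refine Nat.card_congr ((reindex e e).subtypeEquiv fun A ↦ and_congr ?_ (and_congr ?_ ?_))
  · exact ⟨fun h ↦ h.submatrix _, fun h ↦ by simpa using h.submatrix e⟩
  · rw [isUnit_iff_isUnit_det, isUnit_iff_isUnit_det, det_reindex_self]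
  · rw [← e.forall_congr_right (q := fun i ↦ i ∈ Z → reindex e e A i i = 0)]
    simp

/-- The matrix with entry `x` in the corner, `v` as the rest of the corner row and of the corner
column, and `B` as the complementary block. Every symmetric matrix on `Unit ⊕ m` is of this form
for a unique symmetric `B`. -/
def border {R m : Type*} (x : R) (v : m → R) (B : Matrix m m R) :
    Matrix (Unit ⊕ m) (Unit ⊕ m) R :=
  fromBlocks (of fun _ _ ↦ x) (replicateRow Unit v) (replicateCol Unit v) B

section Border

variable {R m : Type*}

theorem border_isSymm_iff {x : R} {v : m → R} {B : Matrix m m R} :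
    (border x v B).IsSymm ↔ B.IsSymm := by
  rw [border, isSymm_fromBlocks_iff]
  exact ⟨fun h ↦ h.2.2.2, fun h ↦ ⟨rfl, rfl, rfl, h⟩⟩

theorem border_toBlocks_eq_self {A : Matrix (Unit ⊕ m) (Unit ⊕ m) R} (hA : A.IsSymm) :
    border (A (.inl ()) (.inl ())) (fun j ↦ A (.inl ()) (.inr j)) A.toBlocks₂₂ = A := by
  ext (i | i) (j | j)
  · rfl
  · rfl
  · exact hA.apply _ _
  · rfl

theorem card_isSymm_border [Finite R] [Finite m] [Fintype {B : Matrix m m R // B.IsSymm}]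
    (P : Matrix (Unit ⊕ m) (Unit ⊕ m) R → Prop) :
    Nat.card {A // A.IsSymm ∧ P A} =
      ∑ B : {B : Matrix m m R // B.IsSymm},
        Nat.card {p : R × (m → R) // P (border p.1 p.2 B)} := by
  rw [← Nat.card_sigma]
  exact Nat.card_congr
    { toFun A := ⟨⟨A.1.toBlocks₂₂, A.2.1.submatrix Sum.inr⟩,
        (A.1 (.inl ()) (.inl ()), fun j ↦ A.1 (.inl ()) (.inr j)),
        (border_toBlocks_eq_self A.2.1).symm ▸ A.2.2⟩
      invFun p := ⟨border p.2.1.1 p.2.1.2 p.1, border_isSymm_iff.2 p.1.2, p.2.2⟩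
      left_inv A := Subtype.ext (border_toBlocks_eq_self A.2.1)
      right_inv _ := rfl }

variable [Fintype m] [DecidableEq m]

theorem adjugate_inl_inl [CommRing R] (A : Matrix (Unit ⊕ m) (Unit ⊕ m) R) :
    A.adjugate (.inl ()) (.inl ()) = A.toBlocks₂₂.det := by
  have hblocks : A.updateRow (.inl ()) (Pi.single (.inl ()) 1) =
      fromBlocks 1 0 A.toBlocks₂₁ A.toBlocks₂₂ := by
    ext (i | i) (j | j) <;> simp [toBlocks₂₁, toBlocks₂₂]
  rw [adjugate_apply, hblocks, det_fromBlocks_zero₁₂, det_one, one_mul]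

theorem det_border [CommRing R] (x : R) (v : m → R) (B : Matrix m m R) :
    (border x v B).det = (border 0 v B).det + x * B.det := by
  have hrow : border x v B = (border 0 v B).updateRow (.inl ())
      (border 0 v B (.inl ()) + x • Pi.single (.inl ()) 1) := by
    ext (i | i) (j | j) <;> simp [border]
  rw [hrow, det_updateRow_add, det_updateRow_smul, updateRow_eq_self, ← adjugate_apply,
    adjugate_inl_inl]
  rfl

theorem det_border_of_isUnit [CommRing R] {B : Matrix m m R} (hB : IsUnit B) (x : R)
    (v : m → R) : (border x v B).det = B.det * (x - v ⬝ᵥ B⁻¹ *ᵥ v) := by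
  let _ := hB.invertible
  rw [border, det_fromBlocks₂₂, invOf_eq_nonsing_inv, det_unique (n := Unit), dotProduct_mulVec]
  rfl

variable {F : Type*} [Field F]

theorem isUnit_border_iff {B : Matrix m m F} (hB : IsUnit B) (x : F) (v : m → F) :
    IsUnit (border x v B) ↔ x ≠ v ⬝ᵥ B⁻¹ *ᵥ v := by
  have hdet : B.det ≠ 0 := ((isUnit_iff_isUnit_det B).1 hB).ne_zero
  rw [isUnit_iff_isUnit_det, det_border_of_isUnit hB, isUnit_iff_ne_zero,
    mul_ne_zero_iff_left hdet, sub_ne_zero]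

theorem isUnit_toBlocks₂₂_iff {A : Matrix (Unit ⊕ m) (Unit ⊕ m) F} (hA : IsUnit A) :
    IsUnit A.toBlocks₂₂ ↔ A⁻¹ (.inl ()) (.inl ()) ≠ 0 := by
  have hdet : A.det ≠ 0 := ((isUnit_iff_isUnit_det A).1 hA).ne_zero
  simp [isUnit_iff_isUnit_det, inv_def, adjugate_inl_inl, hdet]

theorem card_not_isUnit_toBlocks₂₂ :
    Nat.card {A : Matrix (Unit ⊕ m) (Unit ⊕ m) F //
        A.IsSymm ∧ IsUnit A ∧ ¬ IsUnit A.toBlocks₂₂} =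
      Nat.card (InvSymmZeroOn F {(.inl () : Unit ⊕ m)}) := by
  have hinv {A : Matrix (Unit ⊕ m) (Unit ⊕ m) F} (hA : IsUnit A) : A⁻¹⁻¹ = A :=
    nonsing_inv_nonsing_inv A ((isUnit_iff_isUnit_det A).1 hA)
  have hcorner {A : Matrix (Unit ⊕ m) (Unit ⊕ m) F} (hA : IsUnit A) :
      ¬ IsUnit A.toBlocks₂₂ ↔ A⁻¹ (.inl ()) (.inl ()) = 0 :=
    (isUnit_toBlocks₂₂_iff hA).not_left
  exact Nat.card_congr
    { toFun A := ⟨A.1⁻¹, A.2.1.inv, isUnit_nonsing_inv_iff.2 A.2.2.1, by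
        rintro _ rfl
        exact (hcorner A.2.2.1).1 A.2.2.2⟩
      invFun A := ⟨A.1⁻¹, A.2.1.inv, isUnit_nonsing_inv_iff.2 A.2.2.1, by
        rw [hcorner (isUnit_nonsing_inv_iff.2 A.2.2.1), hinv A.2.2.1]
        exact A.2.2.2 _ rfl⟩
      left_inv A := Subtype.ext (hinv A.2.2.1)
      right_inv A := Subtype.ext (hinv A.2.2.1) }

variable [Finite F]

theorem card_isUnit_border (hm : Odd (Fintype.card m)) {B : Matrix m m F} (hB : B.IsSymm) :
    Nat.card {p : F × (m → F) // IsUnit (border p.1 p.2 B)} =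
      Nat.card F * Nat.card {v // IsUnit (border 0 v B)} := by
  classical
  by_cases hunit : IsUnit B
  · have hgraph := card_fst_ne_add_card fun v ↦ v ⬝ᵥ B⁻¹ *ᵥ v
    have hcompl := Nat.card_congr (Equiv.sumCompl fun v ↦ v ⬝ᵥ B⁻¹ *ᵥ v = 0)
    rw [Nat.card_sum] at hcompl
    have hiso := card_mul_card_dotProduct_mulVec_eq_zero hm hB.inv
      (isUnit_nonsing_inv_iff.2 hunit)
    simp only [isUnit_border_iff hunit, ne_comm (a := (0 : F))]
    refine Nat.add_right_cancel (m := Nat.card (m → F)) ?_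
    rw [hgraph, ← hcompl, mul_add, hiso, hcompl, add_comm]
  · have hdet : B.det = 0 := by simpa [isUnit_iff_isUnit_det] using hunit
    have hcorner (x : F) (v : m → F) : IsUnit (border x v B) ↔ IsUnit (border 0 v B) := by
      rw [isUnit_iff_isUnit_det, det_border, hdet, mul_zero, add_zero, ← isUnit_iff_isUnit_det]
    simp only [hcorner]
    rw [← Nat.card_prod]
    exact Nat.card_congr
      { toFun p := (p.1.1, ⟨p.1.2, p.2⟩)
        invFun p := ⟨(p.1, p.2.1), p.2.2⟩
        left_inv _ := rfl
        right_inv _ := rfl }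

theorem card_invSymmZeroOn_of_inl_notMem (hm : Odd (Fintype.card m)) {Z : Set (Unit ⊕ m)}
    (hZ : .inl () ∉ Z) :
    Nat.card (InvSymmZeroOn F Z) =
      Nat.card F * Nat.card (InvSymmZeroOn F (insert (.inl ()) Z)) := by
  let _ : Fintype {B : Matrix m m F // B.IsSymm} := Fintype.ofFinite _
  change Nat.card {A : Matrix (Unit ⊕ m) (Unit ⊕ m) F // A.IsSymm ∧ _} =
    Nat.card F * Nat.card {A : Matrix (Unit ⊕ m) (Unit ⊕ m) F // A.IsSymm ∧ _}
  rw [card_isSymm_border, card_isSymm_border, Finset.mul_sum]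
  refine Finset.sum_congr rfl fun ⟨B, hB⟩ _ ↦ ?_
  have hdiag (x : F) (v : m → F) :
      (∀ i ∈ Z, border x v B i i = 0) ↔ ∀ j, .inr j ∈ Z → B j j = 0 := by
    simp [hZ, border]
  have hcorner (x : F) (v : m → F) : border x v B (.inl ()) (.inl ()) = x := rfl
  by_cases hBZ : ∀ j, .inr j ∈ Z → B j j = 0
  · simp only [Set.forall_mem_insert, hdiag, hcorner, eq_true hBZ, and_true]
    rw [card_isUnit_border hm hB]
    congr 1
    exact Nat.card_congr
      { toFun v := ⟨(0, v.1), v.2, rfl⟩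
        invFun p := ⟨p.1.2, by simpa only [p.2.2] using p.2.1⟩
        left_inv _ := rfl
        right_inv p := Subtype.ext (Prod.ext p.2.2.symm rfl) }
  · simp only [Set.forall_mem_insert, hdiag, hBZ, and_false, Nat.card_of_isEmpty, mul_zero]

theorem card_invSymmZeroOn_unit_sum_add :
    Nat.card (InvSymmZeroOn F (∅ : Set (Unit ⊕ m))) +
        Nat.card (m → F) * Nat.card (InvSymmZeroOn F (∅ : Set m)) =
      Nat.card (InvSymmZeroOn F {(.inl () : Unit ⊕ m)}) +
        Nat.card F * Nat.card (m → F) * Nat.card (InvSymmZeroOn F (∅ : Set m)) := by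
  classical
  let _ : Fintype {B : Matrix m m F // B.IsSymm} := Fintype.ofFinite _
  have hblock (x : F) (v : m → F) (B : Matrix m m F) : (border x v B).toBlocks₂₂ = B := rfl
  have hfiber (B : Matrix m m F) :
      Nat.card {p : F × (m → F) // IsUnit (border p.1 p.2 B)} +
          Nat.card (m → F) * (if IsUnit B then 1 else 0) =
        Nat.card {p : F × (m → F) // IsUnit (border p.1 p.2 B) ∧ ¬ IsUnit B} +
          Nat.card F * Nat.card (m → F) * (if IsUnit B then 1 else 0) := by
    by_cases hB : IsUnit B
    · simpa [isUnit_border_iff hB, hB] using card_fst_ne_add_card fun v ↦ v ⬝ᵥ B⁻¹ *ᵥ v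
    · simp [hB]
  have hsum : Nat.card {B : Matrix m m F // B.IsSymm ∧ IsUnit B} =
      ∑ B : {B : Matrix m m F // B.IsSymm}, if IsUnit B.1 then 1 else 0 := by
    rw [← Nat.card_congr (Equiv.subtypeSubtypeEquivSubtypeInter _ _), Nat.card_eq_fintype_card,
      Fintype.card_subtype, Finset.card_filter]
  rw [← card_not_isUnit_toBlocks₂₂, invSymmZeroOn_empty, invSymmZeroOn_empty]
  simp only [Set.coe_ofPred, hsum, card_isSymm_border, hblock, Finset.mul_sum,
    ← Finset.sum_add_distrib, hfiber]

theorem card_invSymmZeroOn_unit_sum (hm : Odd (Fintype.card m)) :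
    Nat.card (InvSymmZeroOn F (∅ : Set (Unit ⊕ m))) =
      Nat.card F ^ (Fintype.card m + 1) * Nat.card (InvSymmZeroOn F (∅ : Set m)) := by
  have hcorner := card_invSymmZeroOn_of_inl_notMem (F := F) hm (Set.notMem_empty (Sum.inl ()))
  have hminor := card_invSymmZeroOn_unit_sum_add (F := F) (m := m)
  have hpow : Nat.card F ^ (Fintype.card m + 1) = Nat.card F * Nat.card (m → F) := by
    rw [Nat.card_fun, Nat.card_eq_fintype_card (α := m), pow_succ']
  rw [insert_empty_eq] at hcorner
  rw [hpow]
  zify at hcorner hminor ⊢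
  have hq : (Nat.card F : ℤ) - 1 ≠ 0 := sub_ne_zero.2 (by exact_mod_cast Finite.one_lt_card.ne')
  refine mul_left_cancel₀ hq ?_
  linear_combination (Nat.card F : ℤ) * hminor - hcorner

end Border

section Count

variable {F : Type*} [Field F] [Finite F]

theorem card_invSymmZeroOn_of_notMem {ι : Type*} [Fintype ι] [DecidableEq ι]
    (hι : Even (Fintype.card ι)) {i : ι} {Z : Set ι} (hi : i ∉ Z) :
    Nat.card (InvSymmZeroOn F Z) = Nat.card F * Nat.card (InvSymmZeroOn F (insert i Z)) := by
  let e : Unit ⊕ {j // j ≠ i} ≃ ι :=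
    (Equiv.sumCongr (Equiv.ofUnique Unit {j // j = i}) (Equiv.refl _)).trans
      (Equiv.sumCompl (· = i))
  have hinl : e (.inl ()) = i := (default : {j // j = i}).2
  have hodd : Odd (Fintype.card {j // j ≠ i}) := by
    rwa [← Fintype.card_congr e, Fintype.card_sum, Fintype.card_unit, add_comm,
      Nat.even_add_one, Nat.not_even_iff_odd] at hι
  have hinsert : e ⁻¹' insert i Z = insert (.inl ()) (e ⁻¹' Z) := by
    ext x
    simp [← e.injective.eq_iff (b := .inl ()), hinl]
  rw [← card_invSymmZeroOn_preimage e, ← card_invSymmZeroOn_preimage e (insert i Z), hinsert]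
  exact card_invSymmZeroOn_of_inl_notMem hodd (by rwa [Set.mem_preimage, hinl])

theorem pow_card_mul_card_invSymmZeroOn {ι : Type*} [Fintype ι] [DecidableEq ι]
    (hι : Even (Fintype.card ι)) (Z : Finset ι) :
    Nat.card F ^ Z.card * Nat.card (InvSymmZeroOn F (Z : Set ι)) =
      Nat.card (InvSymmZeroOn F (∅ : Set ι)) := by
  induction Z using Finset.induction_on with
  | empty => simp
  | insert i Z hi ih =>
    rw [Finset.card_insert_of_notMem hi, pow_succ, mul_assoc, Finset.coe_insert,
      ← card_invSymmZeroOn_of_notMem hι (by simpa using hi), ih]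

theorem pow_card_mul_ncard_invSymmFirstZero {n k : ℕ} (hn : Even n) (hk : k ≤ n) :
    Nat.card F ^ k * (InvSymmFirstZero F n k).ncard = (InvSymm F n).ncard := by
  have hcount := pow_card_mul_card_invSymmZeroOn (F := F) (by simpa using hn)
    ({i | i < k} : Finset (Fin n))
  rw [Fin.card_filter_val_lt, min_eq_right hk, Finset.coe_filter_univ, invSymmZeroOn_empty]
    at hcount
  exact hcount

theorem ncard_invSymm_succ {m : ℕ} (hm : Odd m) :
    (InvSymm F (m + 1)).ncard = Nat.card F ^ (m + 1) * (InvSymm F m).ncard := by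
  have e : Unit ⊕ Fin m ≃ Fin (m + 1) := Fintype.equivOfCardEq (by simp [add_comm])
  have hcount := card_invSymmZeroOn_unit_sum (F := F) (m := Fin m) (by simpa using hm)
  rw [← Set.preimage_empty (f := e), card_invSymmZeroOn_preimage e, invSymmZeroOn_empty,
    invSymmZeroOn_empty, Fintype.card_fin] at hcount
  exact hcount

end Count

theorem mainTheorem3 (F : Type*) [Field F] [Finite F] (n : ℕ) (hpos : 0 < n) (hn : Even n) :
    (InvSymm F (n - 1)).ncard = (InvSymmZeroDiag F n).ncard ∧
      ∀ k : ℕ, k ≤ n →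
        Nat.card F ^ k * (InvSymmFirstZero F n k).ncard = (InvSymmFirstZero F n 0).ncard ∧
          Nat.card F ^ k * (InvSymmFirstZero F n k).ncard = (InvSymm F n).ncard := by
  have hfree {k : ℕ} (hk : k ≤ n) := pow_card_mul_ncard_invSymmFirstZero (F := F) hn hk
  refine ⟨?_, fun k hk ↦ ⟨by rw [invSymmFirstZero_zero, hfree hk], hfree hk⟩⟩
  obtain ⟨m, rfl⟩ := Nat.exists_eq_add_one.2 hpos
  have hm : Odd m := Nat.not_even_iff_odd.1 (Nat.even_add_one.1 hn)
  refine Nat.eq_of_mul_eq_mul_left (Nat.pow_pos (n := m + 1) (Nat.card_pos (α := F))) ?_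
  rw [Nat.add_sub_cancel, ← ncard_invSymm_succ hm, ← hfree le_rfl, invSymmFirstZero_self]
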